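/- Let $D$ be a set and let $B(D)$ be the space of all bounded complex-valued functions on $D$, equipped with the sup-norm $\|f\|_\infty := \sup_{x\in D}|f(x)|$. Let $V_n$ be an $n$-dimensional (complex linear) subspace of $B(D)$. Then there are points $x_1,\dots,x_{2n}\in D$ (not necessarily distinct) such that, for all $f\in V_n$, $$\|f\|_\infty \;\le\; 58\sqrt{n}\,\Big(\frac{1}{2n}\sum_{k=1}^{2n}|f(x_k)|^2\Big)^{1/2} \;\le\; 42\,\Big(\sum_{k=1}^{2n}|f(x_k)|^2\Big)^{1/2}.$$ -/

import Mathlib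

open scoped ENNReal

/-- The space `B(D)` of all bounded complex-valued functions on a set `D`. It consists of the
`f : D → ℂ` for which `{‖f x‖ | x : D}` is bounded above, it is a complex vector space under
pointwise operations, and its norm is the sup-norm `‖f‖ = ⨆ x, ‖f x‖` (`lp.norm_eq_ciSup`). -/
abbrev BoundedFunctions (D : Type*) : Type _ := lp (fun _ : D => ℂ) ∞

open Matrix

/-! Near-optimal design. Fix a basis `w` of the space and choose `2n` nodes whose Gram determinant
is within a factor 2 of the supremum. Let `K` be the reproducing kernel of the resulting discrete
inner product. Moving the node `x k` to `a` multiplies the determinant by `(1 + K a a) (1 - K (x k)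
(x k)) + |K a (x k)|^2`. Since `∑ K (x k) (x k) = n`, these factors sum to `n + (n + 1) K a a`,
while each is at most 2. Hence `K a a ≤ 3`, and Cauchy–Schwarz gives `|f a|^2 ≤ 3 ∑ |f (x k)|^2`. -/

/-- The matrix of values of a vector-valued function `w` at the nodes `x`. -/
def valueMatrix {D κ ι : Type*} (w : D → ι → ℂ) (x : κ → D) : Matrix κ ι ℂ :=
  Matrix.of fun k => w (x k)

/-- The information matrix `∑ₖ w(xₖ)* w(xₖ)` of the design with nodes `x`. -/
def infoMatrix {D κ ι : Type*} [Fintype κ] (w : D → ι → ℂ) (x : κ → D) : Matrix ι ι ℂ :=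
  (valueMatrix w x)ᴴ * valueMatrix w x

/-- The reproducing kernel of the span of the coordinates of `w` in the inner product given by
the nodes `x`. -/
noncomputable def designKernel {D κ ι : Type*} [Fintype κ] [Fintype ι] [DecidableEq ι]
    (w : D → ι → ℂ) (x : κ → D) (a b : D) : ℂ :=
  w a ⬝ᵥ ((infoMatrix w x)⁻¹ *ᵥ star (w b))

section Design

variable {D κ ι : Type*} [Fintype κ] [DecidableEq κ] [Fintype ι] [DecidableEq ι]
  (w : D → ι → ℂ) (x : κ → D)

omit [DecidableEq κ] [Fintype ι] [DecidableEq ι] in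
theorem infoMatrix_apply (i j : ι) :
    infoMatrix w x i j = ∑ k, star (w (x k) i) * w (x k) j := by
  simp [infoMatrix, valueMatrix, Matrix.mul_apply]

omit [Fintype ι] [DecidableEq ι] in
theorem infoMatrix_update (k : κ) (a : D) :
    infoMatrix w (Function.update x k a) = infoMatrix w x +
      Matrix.of (fun i (s : Fin 2) => ![star (w a i), -star (w (x k) i)] s) *
        Matrix.of ![w a, w (x k)] := by
  ext i j
  have h := Function.comp_update (fun b => star (w b i) * w b j) x k a
  have h1 : ∑ l, star (w (Function.update x k a l) i) * w (Function.update x k a l) j =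
      ∑ l, Function.update ((fun b => star (w b i) * w b j) ∘ x) k
        (star (w a i) * w a j) l :=
    Finset.sum_congr rfl fun l _ => congrFun h l
  have h2 := Finset.add_sum_erase Finset.univ ((fun b => star (w b i) * w b j) ∘ x)
    (Finset.mem_univ k)
  rw [Matrix.add_apply, infoMatrix_apply, infoMatrix_apply, h1,
    Finset.sum_update_of_mem (Finset.mem_univ k), Finset.sdiff_singleton_eq_erase]
  simp only [Function.comp_apply] at h2
  rw [← h2]
  simp [Matrix.mul_apply, Fin.sum_univ_two]
  ring

omit [DecidableEq κ] in
theorem star_designKernel (a b : D) :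
    star (designKernel w x a b) = designKernel w x b a := by
  have h : ((infoMatrix w x)⁻¹)ᴴ = (infoMatrix w x)⁻¹ := by
    rw [Matrix.conjTranspose_nonsing_inv, infoMatrix, Matrix.conjTranspose_mul,
      Matrix.conjTranspose_conjTranspose]
  rw [designKernel, designKernel, ← Matrix.star_dotProduct_star, Matrix.star_mulVec, star_star, h,
    Matrix.dotProduct_mulVec]

/-- An exchange is a rank-two update, so the matrix determinant lemma leaves a 2×2 determinant of
kernel values. -/
theorem det_infoMatrix_update (hdet : (infoMatrix w x).det ≠ 0) (k : κ) (a : D) :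
    (infoMatrix w (Function.update x k a)).det = (infoMatrix w x).det *
      ((1 + designKernel w x a a) * (1 - designKernel w x (x k) (x k)) +
        designKernel w x a (x k) * star (designKernel w x a (x k))) := by
  rw [infoMatrix_update, Matrix.det_add_mul _ _ (isUnit_iff_ne_zero.mpr hdet), star_designKernel,
    Matrix.det_fin_two]
  have h : ∀ (s t : Fin 2), (Matrix.of ![w a, w (x k)] * (infoMatrix w x)⁻¹ *
      Matrix.of (fun i (s : Fin 2) => ![star (w a i), -star (w (x k) i)] s)) s t =
      ![w a, w (x k)] s ⬝ᵥ ((infoMatrix w x)⁻¹ *ᵥ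
        fun i => ![star (w a i), -star (w (x k) i)] t) := by
    intro s t
    rw [Matrix.mul_assoc]
    rfl
  have hneg : (fun i => -star (w (x k) i)) = -star (w (x k)) := rfl
  have hpos : (fun i => star (w a i)) = star (w a) := rfl
  simp only [Matrix.add_apply, h]
  simp only [Matrix.cons_val_zero, Matrix.cons_val_one, hneg, hpos, Matrix.mulVec_neg,
    dotProduct_neg, Matrix.one_apply_eq, Matrix.one_apply_ne zero_ne_one,
    Matrix.one_apply_ne one_ne_zero, designKernel]
  ring

omit [DecidableEq κ] in
theorem sum_designKernel_mul (hdet : (infoMatrix w x).det ≠ 0) (a : D) (c : ι → ℂ) :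
    ∑ k, designKernel w x a (x k) * (w (x k) ⬝ᵥ c) = w a ⬝ᵥ c := by
  have h1 : ∀ k, designKernel w x a (x k) =
      ((w a ᵥ* (infoMatrix w x)⁻¹) ᵥ* (valueMatrix w x)ᴴ) k := by
    intro k
    rw [designKernel, Matrix.dotProduct_mulVec]
    rfl
  have h2 : ∀ k, w (x k) ⬝ᵥ c = (valueMatrix w x *ᵥ c) k := fun k => rfl
  simp only [h1, h2]
  change (_ ᵥ* _) ⬝ᵥ (_ *ᵥ c) = _
  rw [Matrix.dotProduct_mulVec, Matrix.vecMul_vecMul, Matrix.vecMul_vecMul, ← Matrix.mul_assoc,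
    Matrix.mul_assoc]
  change (_ ᵥ* (_ * infoMatrix w x)) ⬝ᵥ c = _
  rw [Matrix.nonsing_inv_mul _ (isUnit_iff_ne_zero.mpr hdet), Matrix.vecMul_one]

omit [DecidableEq κ] in
theorem sum_designKernel_mul_star (hdet : (infoMatrix w x).det ≠ 0) (a : D) :
    ∑ k, designKernel w x a (x k) * star (designKernel w x a (x k)) = designKernel w x a a := by
  simp only [star_designKernel]
  exact sum_designKernel_mul w x hdet a _

-- By cyclicity, the trace of the projection onto the range of the value matrix equals that of the
-- identity on `ι`.
omit [DecidableEq κ] in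
theorem sum_designKernel_diag (hdet : (infoMatrix w x).det ≠ 0) :
    ∑ k, designKernel w x (x k) (x k) = Fintype.card ι := by
  have h : ∀ k, designKernel w x (x k) (x k) =
      (valueMatrix w x * ((infoMatrix w x)⁻¹ * (valueMatrix w x)ᴴ)) k k := fun k => rfl
  simp only [h]
  change Matrix.trace _ = _
  rw [Matrix.trace_mul_comm, Matrix.mul_assoc]
  change Matrix.trace (_ * infoMatrix w x) = _
  rw [Matrix.nonsing_inv_mul _ (isUnit_iff_ne_zero.mpr hdet), Matrix.trace_one]

theorem sum_det_infoMatrix_update (hdet : (infoMatrix w x).det ≠ 0) (a : D) :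
    ∑ k, (infoMatrix w (Function.update x k a)).det = (infoMatrix w x).det *
      ((1 + designKernel w x a a) * (Fintype.card κ - Fintype.card ι) +
        designKernel w x a a) := by
  simp only [det_infoMatrix_update w x hdet]
  rw [← Finset.mul_sum, Finset.sum_add_distrib, sum_designKernel_mul_star w x hdet,
    ← Finset.mul_sum, Finset.sum_sub_distrib, sum_designKernel_diag w x hdet]
  simp

omit [DecidableEq κ] in
theorem designKernel_self (hdet : (infoMatrix w x).det ≠ 0) (a : D) :
    designKernel w x a a = ((∑ k, ‖designKernel w x a (x k)‖ ^ 2 : ℝ) : ℂ) := by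
  rw [← sum_designKernel_mul_star w x hdet]
  push_cast
  exact Finset.sum_congr rfl fun k _ => Complex.mul_conj' _

/-- If no exchange of a single node increases the determinant by more than a factor `C`, then
the design controls point evaluations. -/
theorem sum_norm_designKernel_le {C : ℝ} (hcard : Fintype.card κ = 2 * Fintype.card ι)
    (hdet : (infoMatrix w x).det ≠ 0) (a : D)
    (hC : ∀ k, ‖(infoMatrix w (Function.update x k a)).det‖ ≤ C * ‖(infoMatrix w x).det‖) :
    Fintype.card ι + (Fintype.card ι + 1) * ∑ k, ‖designKernel w x a (x k)‖ ^ 2 ≤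
      2 * Fintype.card ι * C := by
  have h := sum_det_infoMatrix_update w x hdet a
  have hpos : 0 < ‖(infoMatrix w x).det‖ := norm_pos_iff.mpr hdet
  have h1 : ‖∑ k, (infoMatrix w (Function.update x k a)).det‖ ≤
      2 * Fintype.card ι * (C * ‖(infoMatrix w x).det‖) := by
    refine (norm_sum_le _ _).trans ((Finset.sum_le_sum fun k _ => hC k).trans_eq ?_)
    simp [hcard]
  have h2 : (1 + designKernel w x a a) * ((Fintype.card κ : ℂ) - Fintype.card ι) +
        designKernel w x a a = ((Fintype.card ι + (Fintype.card ι + 1) *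
          ∑ k, ‖designKernel w x a (x k)‖ ^ 2 : ℝ) : ℂ) := by
    rw [designKernel_self w x hdet, hcard]
    push_cast
    ring
  rw [h, h2, norm_mul, Complex.norm_real, Real.norm_of_nonneg (by positivity)] at h1
  refine le_of_mul_le_mul_left (h1.trans_eq ?_) hpos
  ring

omit [DecidableEq κ] in
theorem norm_dotProduct_sq_le (hdet : (infoMatrix w x).det ≠ 0) (a : D) (c : ι → ℂ) :
    ‖w a ⬝ᵥ c‖ ^ 2 ≤
      (∑ k, ‖designKernel w x a (x k)‖ ^ 2) * ∑ k, ‖w (x k) ⬝ᵥ c‖ ^ 2 := by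
  rw [← sum_designKernel_mul w x hdet a c]
  refine le_trans ?_ (Finset.sum_mul_sq_le_sq_mul_sq _ _ _)
  gcongr
  refine (norm_sum_le _ _).trans_eq ?_
  simp

omit [DecidableEq κ] in
theorem exists_norm_det_infoMatrix_le {B : ℝ} (hB : ∀ a i, ‖w a i‖ ≤ B) :
    ∃ K, ∀ y : κ → D, ‖(infoMatrix w y).det‖ ≤ K := by
  refine ⟨_, fun y => Matrix.det_le (abv := NormedField.toAbsoluteValue ℂ)
    (x := Fintype.card κ * (B * B)) fun i j => ?_⟩
  change ‖infoMatrix w y i j‖ ≤ _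
  rw [infoMatrix_apply]
  refine (norm_sum_le _ _).trans ((Finset.sum_le_sum (g := fun _ => B * B) fun k _ => ?_).trans_eq
    (by simp))
  rw [norm_mul, norm_star]
  exact mul_le_mul (hB _ _) (hB _ _) (norm_nonneg _) ((norm_nonneg _).trans (hB (y k) i))

end Design

-- Independence makes the vectors `w a` span, so some nodes give a basis; the spare nodes cannot
-- enlarge the kernel.
open scoped ComplexOrder in
theorem exists_det_infoMatrix_ne_zero {D κ ι : Type*} [Fintype κ] [Fintype ι] [DecidableEq ι]
    [Nonempty D] {w : D → ι → ℂ} (hw : LinearIndependent ℂ fun i a => w a i)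
    (hcard : Fintype.card ι ≤ Fintype.card κ) :
    ∃ y : κ → D, (infoMatrix w y).det ≠ 0 := by
  have hspan : Submodule.span ℂ (Set.range w) = ⊤ :=
    span_flip_eq_top_iff_linearIndependent.mpr hw
  obtain ⟨f, hf, hfs, -⟩ := Submodule.exists_fun_fin_finrank_span_eq ℂ (Set.range w)
  choose z hz using hf
  have hr : Module.finrank ℂ (Submodule.span ℂ (Set.range w)) = Fintype.card ι := by
    rw [hspan, finrank_top, Module.finrank_fintype_fun_eq_card]
  obtain ⟨e⟩ : Nonempty (Fin (Module.finrank ℂ (Submodule.span ℂ (Set.range w))) ↪ κ) :=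
    Function.Embedding.nonempty_of_card_le (by simpa [hr] using hcard)
  refine ⟨Function.extend e z fun _ => Classical.arbitrary D, fun h0 => ?_⟩
  obtain ⟨c, hc, hGc⟩ := Matrix.exists_mulVec_eq_zero_iff.mpr h0
  rw [infoMatrix, Matrix.conjTranspose_mul_self_mulVec_eq_zero] at hGc
  have hv : ∀ v ∈ Submodule.span ℂ (Set.range f), v ⬝ᵥ c = 0 := by
    intro v hv
    induction hv using Submodule.span_induction with
    | mem v hv =>
      obtain ⟨j, rfl⟩ := hv
      have := congrFun hGc (e j)
      simpa [valueMatrix, Matrix.mulVec, e.injective.extend_apply, hz] using this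
    | zero => simp
    | add u v _ _ hu hv => rw [add_dotProduct, hu, hv, add_zero]
    | smul r v _ hv => rw [smul_dotProduct, hv, smul_zero]
  refine hc (dotProduct_eq_zero c fun v => ?_)
  rw [dotProduct_comm]
  exact hv v (by rw [hfs, hspan]; trivial)

/-- Bounded linearly independent functions admit a design of twice their number of nodes whose
values control the sup-norm on their span. -/
theorem exists_nodes_norm_dotProduct_sq_le {D κ ι : Type*} [Fintype κ] [Fintype ι] [Nonempty D]
    {w : D → ι → ℂ} (hw : LinearIndependent ℂ fun i a => w a i) {B : ℝ}
    (hB : ∀ a i, ‖w a i‖ ≤ B) (hcard : Fintype.card κ = 2 * Fintype.card ι) :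
    ∃ x : κ → D, ∀ a c, ‖w a ⬝ᵥ c‖ ^ 2 ≤ 3 * ∑ k, ‖w (x k) ⬝ᵥ c‖ ^ 2 := by
  classical
  obtain ⟨K, hK⟩ := exists_norm_det_infoMatrix_le (κ := κ) w hB
  obtain ⟨y, hy⟩ := exists_det_infoMatrix_ne_zero (κ := κ) hw (by omega)
  have hbdd : BddAbove (Set.range fun z : κ → D => ‖(infoMatrix w z).det‖) :=
    ⟨K, by rintro _ ⟨z, rfl⟩; exact hK z⟩
  have hpos : 0 < ⨆ z : κ → D, ‖(infoMatrix w z).det‖ :=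
    (norm_pos_iff.mpr hy).trans_le (le_ciSup hbdd y)
  -- The supremum need not be attained on an arbitrary `D`; half of it suffices.
  obtain ⟨x, hx⟩ := exists_lt_of_lt_ciSup (half_lt_self hpos)
  have hdet : (infoMatrix w x).det ≠ 0 := norm_pos_iff.mp ((half_pos hpos).trans hx)
  refine ⟨x, fun a c => (norm_dotProduct_sq_le w x hdet a c).trans ?_⟩
  have h := sum_norm_designKernel_le (C := 2) w x hcard hdet a fun k =>
    (le_ciSup hbdd (Function.update x k a)).trans (by linarith)
  gcongr
  have hn : (0 : ℝ) ≤ Fintype.card ι := Nat.cast_nonneg _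
  by_contra! h3
  -- `n + (n + 1) s ≤ 4 n` is incompatible with `s > 3`.
  nlinarith

theorem theorem2 {D : Type*} (n : ℕ) (V : Submodule ℂ (BoundedFunctions D))
    [FiniteDimensional ℂ V] (hV : Module.finrank ℂ V = n) :
    ∃ x : Fin (2 * n) → D, ∀ f ∈ V,
      ‖f‖ ≤ 58 * √(n : ℝ) * √(1 / (2 * (n : ℝ)) * ∑ k, ‖f (x k)‖ ^ 2) ∧
      58 * √(n : ℝ) * √(1 / (2 * (n : ℝ)) * ∑ k, ‖f (x k)‖ ^ 2) ≤
        42 * √(∑ k, ‖f (x k)‖ ^ 2) := by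
  rcases Nat.eq_zero_or_pos n with rfl | hn
  · refine ⟨fun k => k.elim0, fun f hf => ?_⟩
    have hf0 : f = 0 := by
      rw [Submodule.finrank_eq_zero.mp hV] at hf
      exact (Submodule.mem_bot ℂ).mp hf
    simp [hf0]
  have hD : Nonempty D := by
    by_contra hD
    rw [not_nonempty_iff] at hD
    have : Subsingleton (BoundedFunctions D) := ⟨fun f g => by ext a; exact hD.elim a⟩
    have := Module.finrank_zero_of_subsingleton (R := ℂ) (M := V)
    omega
  have : Module.Free ℂ V := Module.Free.of_divisionRing ℂ V
  let b := Module.finBasisOfFinrankEq ℂ V hV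
  let w : D → Fin n → ℂ := fun a i => (b i : BoundedFunctions D) a
  let ev : D → V →ₗ[ℂ] ℂ := fun a =>
    { toFun := fun f => (f : BoundedFunctions D) a
      map_add' := fun _ _ => rfl
      map_smul' := fun _ _ => rfl }
  have hval : ∀ (f : V) (a : D), (f : BoundedFunctions D) a = w a ⬝ᵥ b.repr f := by
    intro f a
    change ev a f = _
    conv_lhs => rw [← b.sum_repr f]
    rw [map_sum]
    exact Finset.sum_congr rfl fun i _ => (map_smul _ _ _).trans (mul_comm _ _)
  have hw : LinearIndependent ℂ fun i a => w a i := by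
    rw [Fintype.linearIndependent_iff]
    intro g hg
    refine Fintype.linearIndependent_iff.mp b.linearIndependent g ?_
    ext a
    change ev a (∑ i, g i • b i) = 0
    have h : ∑ i, g i * w a i = 0 := by simpa using congrFun hg a
    rw [map_sum, ← h]
    exact Finset.sum_congr rfl fun i _ => map_smul _ _ _
  have hB : ∀ a i, ‖w a i‖ ≤ ∑ j, ‖(b j : BoundedFunctions D)‖ := fun a i =>
    (lp.norm_apply_le_norm ENNReal.top_ne_zero _ a).trans
      (Finset.single_le_sum (f := fun j => ‖(b j : BoundedFunctions D)‖)
        (fun _ _ => norm_nonneg _) (Finset.mem_univ i))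
  obtain ⟨x, hx⟩ := exists_nodes_norm_dotProduct_sq_le (κ := Fin (2 * n)) hw hB (by simp)
  refine ⟨x, fun f hf => ?_⟩
  set S := ∑ k, ‖f (x k)‖ ^ 2 with hS
  have hS0 : 0 ≤ S := by positivity
  -- Here `1682 = 58 ^ 2 / 2`, and `3 ≤ 1682 ≤ 42 ^ 2` leaves ample room.
  have hmid : 58 * √(n : ℝ) * √(1 / (2 * (n : ℝ)) * S) = √(1682 * S) := by
    have hn' : (0 : ℝ) < n := by exact_mod_cast hn
    rw [show (58 : ℝ) = √(58 ^ 2) by simp, ← Real.sqrt_mul (by positivity),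
      ← Real.sqrt_mul (by positivity)]
    congr 1
    field_simp
    ring
  rw [hmid]
  constructor
  · refine lp.norm_le_of_forall_le (Real.sqrt_nonneg _) fun a => Real.le_sqrt_of_sq_le ?_
    have h := hx a (b.repr ⟨f, hf⟩)
    simp only [← hval] at h
    change ‖f a‖ ^ 2 ≤ 3 * S at h
    linarith
  · rw [show (42 : ℝ) = √(42 ^ 2) by simp, ← Real.sqrt_mul (by positivity)]
    exact Real.sqrt_le_sqrt (by linarith)
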